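/- Let $n\ge 0$, let $\pm[n]=\{-n,\dots,-1,0,1,\dots,n\}$, and let $\mathfrak B_n$ be the hyperoctahedral group, i.e. the group (under composition) of all bijections $\pi:\pm[n]\to\pm[n]$ with $\pi(-i)=-\pi(i)$. For a natural number $k$ let $\pm[k]'$ be the set of $4k+1$ formal symbols with the total order $$-k<-k^{-1}<\cdots<-1<-1^{-1}<0<1^{-1}<1<\cdots<k^{-1}<k ,$$ with the evident negation, and let $\varepsilon(x)=-1$ if $x=\pm j^{-1}$ for some $j$ and $\varepsilon(x)=1$ otherwise. Write $x\le^{+}y$ if $x<y$, or $x=y$ and $\varepsilon(x)=1$; write $x\le^{-}y$ if $x<y$, or $x=y$ and $\varepsilon(x)=-1$. For $\pi\in\mathfrak B_n$ let $<_\pi$ be the total order $\pi(-n)<_\pi\cdots<_\pi\pi(-1)<_\pi 0<_\pi\pi(1)<_\pi\cdots<_\pi\pi(n)$ on $\pm[n]$, and let $\Omega'_B(\pi;k)$ be the number of maps $f:\pm[n]\to\pm[k]'$ such that $f(-i)=-f(i)$ for all $i$ and, whenever $i<_\pi j$: $f(i)\le^{+}f(j)$ if $i<j$ in $\mathbb Z$,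 and $f(i)\le^{-}f(j)$ if $i>j$ in $\mathbb Z$. Then: 1. For every $\pi\in\mathfrak B_n$ there is a (unique) polynomial $\Omega'_B(\pi;x)\in\mathbb Q[x]$, of degree at most $n$, whose value at every integer $k\ge 0$ is the number $\Omega'_B(\pi;k)$. 2. For every $\pi\in\mathfrak B_n$ and all integers $k,l\ge 0$, $$\Omega'_B(\pi;4kl+k+l)=\sum_{\sigma\tau=\pi}\Omega'_B(\sigma;k)\,\Omega'_B(\tau;l),$$ the sum being over all pairs $(\sigma,\tau)\in\mathfrak B_n\times\mathfrak B_n$ with $\sigma\tau=\pi$. 3. Put $\rho_B(x)=\sum_{\pi\in\mathfrak B_n}\Omega'_B\!\left(\pi;\tfrac{x-1}{4}\right)\pi$, a polynomial in $x$ with coefficients in the group algebra $\mathbb Q[\mathfrak B_n]$. As polynomials in two commuting variables $x,y$ with coefficients in $\mathbb Q[\mathfrak B_n]$, $$\rho_B(x)\,\rho_B(y)=\rho_B(xy).$$ 4. Write $\rho_B(x)=\sum_{i=0}^{n}e'_i x^i$. The $n+1$ elements $e'_0,\dots,e'_n$ of $\mathbb Q[\mathfrak B_n]$ are nonzero orthogonal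 idempotents: $e'_i\neq 0$ and $e'_ie'_j=\delta_{ij}e'_i$ for all $0\le i,j\le n$. -/

import Mathlib

open Polynomial

noncomputable section

/-- The set `±[n] = {-n, …, -1, 0, 1, …, n}`, with the order of the integers. -/
abbrev PMInt (n : ℕ) : Type := {z : ℤ // z ∈ Finset.Icc (-(n : ℤ)) (n : ℤ)}

instance PMInt.instNeg (n : ℕ) : Neg (PMInt n) where
  neg i := ⟨-i.1, by
    have h := Finset.mem_Icc.mp i.2
    exact Finset.mem_Icc.mpr ⟨by omega, by omega⟩⟩

theorem PMInt.neg_lt_neg {n : ℕ} {i j : PMInt n} (h : i < j) : -j < -i :=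
  show -j.1 < -i.1 from Int.neg_lt_neg h

/-- The hyperoctahedral group `𝔅_n`: the bijections `π` of `±[n]` with `π(-i) = -π(i)`,
under composition. -/
def signedPerm (n : ℕ) : Subgroup (Equiv.Perm (PMInt n)) where
  carrier := {π | ∀ i, π (-i) = -π i}
  one_mem' := fun _ => rfl
  mul_mem' := by
    intro σ τ hσ hτ i
    rw [Equiv.Perm.mul_apply, Equiv.Perm.mul_apply, hτ, hσ]
  inv_mem' := by
    intro σ hσ i
    have h : σ (σ⁻¹ i) = i := σ.apply_symm_apply i
    rw [Equiv.Perm.inv_eq_iff_eq, hσ, h]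

instance signedPerm.instFintype (n : ℕ) : Fintype (signedPerm n) := Fintype.ofFinite _

/-- A type B poset: a (strict) partial order `<_P` on `±[n]` such that `i <_P j` implies
`-j <_P -i`. -/
structure TypeBPoset (n : ℕ) where
  lt : PMInt n → PMInt n → Prop
  irrefl : ∀ i, ¬ lt i i
  trans : ∀ i j l, lt i j → lt j l → lt i l
  symm : ∀ i j, lt i j → lt (-j) (-i)

/-- A signed permutation as a type B poset: the total order
`π(-n) <_π ⋯ <_π π(-1) <_π 0 <_π π(1) <_π ⋯ <_π π(n)`. -/
def permPoset {n : ℕ} (π : signedPerm n) : TypeBPoset n where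
  lt a b := (π : Equiv.Perm (PMInt n)).symm a < (π : Equiv.Perm (PMInt n)).symm b
  irrefl _ := lt_irrefl _
  trans _ _ _ := lt_trans
  symm a b h := by
    have hs : ∀ i, (π : Equiv.Perm (PMInt n)).symm (-i) = -(π : Equiv.Perm (PMInt n)).symm i :=
      (signedPerm n).inv_mem π.2
    rw [hs, hs]
    exact PMInt.neg_lt_neg h

/-- The totally ordered set `±[k]'`, that is
`-k < -k⁻¹ < ⋯ < -1 < -1⁻¹ < 0 < 1⁻¹ < 1 < ⋯ < k⁻¹ < k` (where `j⁻¹` is a formal symbol).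
Its `4k + 1` elements are represented by their rank: `±j` by the integer `±2j`, `±j⁻¹` by
`±(2j - 1)`, and `0` by `0`. Order and negation are those of the integers; the exponent `ε` is
positive on the elements `±j` and `0` (even ranks), negative on the elements `±j⁻¹` (odd ranks). -/
abbrev PMPrime (k : ℕ) : Type := PMInt (2 * k)

/-- The element `x` of `±[k]'` has positive exponent. -/
def PMPrime.EpsPos {k : ℕ} (x : PMPrime k) : Prop := Even x.1

/-- `x ≤⁺ y`: either `x < y`, or `x = y` and `ε(x) > 0`. -/
def PMPrime.lePlus {k : ℕ} (x y : PMPrime k) : Prop := x < y ∨ (x = y ∧ x.EpsPos)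

/-- `x ≤⁻ y`: either `x < y`, or `x = y` and `ε(x) < 0`. -/
def PMPrime.leMinus {k : ℕ} (x y : PMPrime k) : Prop := x < y ∨ (x = y ∧ ¬ x.EpsPos)

/-- `f : ±[n] → ±[k]'` is a type B enriched `P`-partition. -/
structure IsEnrichedPartition {n : ℕ} (P : TypeBPoset n) (k : ℕ) (f : PMInt n → PMPrime k) :
    Prop where
  map_neg : ∀ i, f (-i) = -f i
  lePlus : ∀ i j, P.lt i j → i < j → (f i).lePlus (f j)
  leMinus : ∀ i j, P.lt i j → j < i → (f i).leMinus (f j)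

/-- `Ω'_B(P; k)` for a natural number `k`: the number of type B enriched `P`-partitions
`f : ±[n] → ±[k]'`. -/
def enrichedCount {n : ℕ} (P : TypeBPoset n) (k : ℕ) : ℕ :=
  Nat.card {f : PMInt n → PMPrime k // IsEnrichedPartition P k f}

/-- The type B enriched order polynomial `Ω'_B(P; x)`, of degree at most `n`, given by its values
`Ω'_B(P; k)` at `k = 0, 1, …, n`. -/
def enrichedOrderPoly {n : ℕ} (P : TypeBPoset n) : ℚ[X] :=
  Lagrange.interpolate (Finset.range (n + 1)) (fun k : ℕ => (k : ℚ))
    (fun k : ℕ => (enrichedCount P k : ℚ))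

/-- The group algebra `ℚ[𝔅_n]`. -/
abbrev HypAlg (n : ℕ) : Type := MonoidAlgebra ℚ (signedPerm n)

/-- `ρ_B(x) = ∑_{π ∈ 𝔅_n} Ω'_B(π; (x - 1)/4) π`, a polynomial with coefficients in the group
algebra. -/
def rhoB (n : ℕ) : (HypAlg n)[X] :=
  ∑ π : signedPerm n,
    ((enrichedOrderPoly (permPoset π)).comp (C (1 / 4 : ℚ) * (X - 1))).map
        (algebraMap ℚ (HypAlg n)) * C (MonoidAlgebra.of ℚ (signedPerm n) π)

/-- The element `e'_i` of the group algebra: the coefficient of `x^i` in `ρ_B(x)`. -/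
def ePrime (n i : ℕ) : HypAlg n := (rhoB n).coeff i

/-- For a polynomial `p = ∑ a_i x^i` over a ring `A` and a polynomial `t` in two (central)
variables over `A`, the two-variable polynomial `p(t) = ∑ a_i t^i`. In `A[X][X]` the first variable
is `C X` and the second is `X`. -/
def subst₂ {A : Type*} [Ring A] (p : A[X]) (t : A[X][X]) : A[X][X] :=
  p.eval₂ (C.comp C) t

end

/-! Call a map `±[n] → ±[m]` odd if it commutes with negation. Sort `±[n]` by the values of an odd
map, breaking ties by increasing index at even ranks and by decreasing index at odd ranks. Exactly
one signed permutation, `sortPerm f`, does this, and it is the only `π` for which `f` is an enriched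
partition (`isEnrichedPartition_permPoset_iff`). So the numbers `Ω'_B(π; k)` are the fibre sizes of
`sortPerm` on all odd maps to `±[k]'`.

Product formula: order pairs in `±[l]' × ±[k]'` lexicographically, reversing the second entry when
the first is odd. This is a copy of `±[4kl + k + l]'`, and parities add. Pairing `f` with `g`
reindexed by `sortPerm f` is a bijection under which the sorting permutations multiply
(`sortPerm_combine`, `combine_bijective`); counting fibres gives the convolution.

Polynomiality: `f` is determined by its values along `π(0), …, π(n)`, a weakly increasing chain from
0 in which a repeated value must be even at ascents and odd at descents. A recursion on the length
shows that the differences of order `n + 1` of the counts vanish.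

Idempotents: at `x = 4k + 1`, `ρ_B` is `∑ Ω'_B(π; k) π`, and `(4k + 1)(4l + 1) = 4(4kl + k + l) +
1`. Infinitely many such points allow comparison of coefficients, first in `x`, then in `y`, which
gives orthogonality, and from it the identity for `ρ_B`. For nonvanishing, a sign functional sends
`ρ_B(4k + 1)` to `(4k + 1)^i`, hence `e'_i` to 1. -/

@[simp]
theorem PMInt.coe_neg {n : ℕ} (i : PMInt n) : ((-i : PMInt n) : ℤ) = -(i : ℤ) := rfl

theorem PMInt.neg_neg {n : ℕ} (i : PMInt n) : - -i = i := Subtype.ext (Int.neg_neg i.1)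

theorem PMInt.lt_neg_iff {n : ℕ} {i j : PMInt n} : -i < -j ↔ j < i :=
  ⟨fun h => by simpa only [PMInt.neg_neg] using PMInt.neg_lt_neg h, PMInt.neg_lt_neg⟩

theorem PMInt.neg_le {n : ℕ} (i : PMInt n) : -(n : ℤ) ≤ i.1 := (Finset.mem_Icc.mp i.2).1

theorem PMInt.le {n : ℕ} (i : PMInt n) : i.1 ≤ n := (Finset.mem_Icc.mp i.2).2

theorem PMInt.card (n : ℕ) : Fintype.card (PMInt n) = 2 * n + 1 := by
  rw [Fintype.card_coe, Int.card_Icc]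
  omega

/-! ### Odd maps and the signed permutations that sort them -/

/-- The maps `±[n] → ±[m]` that commute with negation. -/
abbrev OddMap (n m : ℕ) : Type := {f : PMInt n → PMInt m // ∀ i, f (-i) = -f i}

/-- The key by which a map sorts `±[n]`: first by the value, then by the index, increasingly
for even and decreasingly for odd values. -/
def sortKey {n m : ℕ} (f : PMInt n → PMInt m) (a : PMInt n) : ℤ ×ₗ ℤ :=
  toLex ((f a).1, if Even (f a).1 then a.1 else -a.1)

theorem sortKey_lt_iff {n m : ℕ} {f : PMInt n → PMInt m} {a b : PMInt n} :
    sortKey f a < sortKey f b ↔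
      f a < f b ∨ (f a = f b ∧ if Even (f a).1 then a < b else b < a) := by
  rw [sortKey, sortKey, Prod.Lex.toLex_lt_toLex, Subtype.coe_lt_coe, Subtype.coe_inj]
  refine or_congr_right (and_congr_right fun h => ?_)
  rw [← h]
  split_ifs
  · exact Subtype.coe_lt_coe
  · exact Int.neg_lt_neg_iff

theorem sortKey_injective {n m : ℕ} (f : PMInt n → PMInt m) : Function.Injective (sortKey f) := by
  intro a b h
  have h' := Prod.ext_iff.mp (toLex.injective h)
  simp only at h'
  obtain ⟨h1, h2⟩ := h'
  rw [h1] at h2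
  apply Subtype.ext
  split_ifs at h2 <;> omega

/-- Negation preserves the parity of the value, so it changes the sign of both entries of the key.
-/
theorem sortKey_neg_lt_iff {n m : ℕ} (f : OddMap n m) {a b : PMInt n} :
    sortKey f.1 (-a) < sortKey f.1 (-b) ↔ sortKey f.1 b < sortKey f.1 a := by
  have hinj : (-f.1 a = -f.1 b) ↔ f.1 b = f.1 a :=
    ⟨fun h => by rw [← PMInt.neg_neg (f.1 a), h, PMInt.neg_neg], fun h => by rw [h]⟩
  rw [sortKey_lt_iff, sortKey_lt_iff, f.2, f.2, PMInt.lt_neg_iff, hinj]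
  refine or_congr_right (and_congr_right fun h => ?_)
  simp only [PMInt.coe_neg, even_neg, h, PMInt.lt_neg_iff]

theorem exists_perm_strictMono {α β : Type*} [Fintype α] [LinearOrder α] [LinearOrder β]
    {key : α → β} (hkey : Function.Injective key) : ∃ π : Equiv.Perm α, StrictMono (key ∘ π) := by
  let e := monoEquivOfFin α rfl
  let s := Tuple.sort (key ∘ e)
  refine ⟨e.toEquiv.symm.trans (s.trans e.toEquiv), ?_⟩
  have h := (Tuple.monotone_sort (key ∘ e)).strictMono_of_injective
    ((hkey.comp e.injective).comp s.injective)
  exact h.comp e.symm.strictMono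

theorem perm_unique_of_strictMono {α β : Type*} [Fintype α] [LinearOrder α] [LinearOrder β]
    {key : α → β} (hkey : Function.Injective key) {π σ : Equiv.Perm α}
    (hπ : StrictMono (key ∘ π)) (hσ : StrictMono (key ∘ σ)) : π = σ := by
  have h := (hπ.range_inj hσ).mp (by rw [π.surjective.range_comp, σ.surjective.range_comp])
  exact Equiv.ext fun i => hkey (congrFun h i)

theorem existsUnique_signedPerm_strictMono {n m : ℕ} (f : OddMap n m) :
    ∃! π : signedPerm n, StrictMono (sortKey f.1 ∘ (π : Equiv.Perm (PMInt n))) := by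
  obtain ⟨π, hπ⟩ := exists_perm_strictMono (sortKey_injective f.1)
  let ν : Equiv.Perm (PMInt n) := ⟨fun i => -i, fun i => -i, PMInt.neg_neg, PMInt.neg_neg⟩
  -- Conjugating by negation gives another sorting permutation; uniqueness then forces `π` to be
  -- odd.
  have hν : StrictMono (sortKey f.1 ∘ (ν * π * ν : Equiv.Perm (PMInt n))) := fun i j hij =>
    (sortKey_neg_lt_iff f).mpr (hπ (PMInt.neg_lt_neg hij))
  have heq := perm_unique_of_strictMono (sortKey_injective f.1) hν hπ
  refine ⟨⟨π, fun i => ?_⟩, hπ, fun σ hσ =>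
    Subtype.ext (perm_unique_of_strictMono (sortKey_injective f.1) hσ hπ)⟩
  calc π (-i) = - -π (-i) := (PMInt.neg_neg _).symm
    _ = -(ν * π * ν) i := rfl
    _ = -π i := by rw [heq]

/-- The signed permutation that sorts `±[n]` by `sortKey f`. -/
noncomputable def sortPerm {n m : ℕ} (f : OddMap n m) : signedPerm n :=
  (existsUnique_signedPerm_strictMono f).choose

theorem sortPerm_strictMono {n m : ℕ} (f : OddMap n m) :
    StrictMono (sortKey f.1 ∘ (sortPerm f : Equiv.Perm (PMInt n))) :=
  (existsUnique_signedPerm_strictMono f).choose_spec.1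

theorem sortPerm_eq_iff {n m : ℕ} {f : OddMap n m} {π : signedPerm n} :
    sortPerm f = π ↔ StrictMono (sortKey f.1 ∘ (π : Equiv.Perm (PMInt n))) :=
  ⟨fun h => h ▸ sortPerm_strictMono f,
    fun h => (existsUnique_signedPerm_strictMono f).unique (sortPerm_strictMono f) h⟩

theorem sortPerm_symm_lt_iff {n m : ℕ} (f : OddMap n m) {a b : PMInt n} :
    (sortPerm f : Equiv.Perm (PMInt n)).symm a < (sortPerm f : Equiv.Perm (PMInt n)).symm b ↔
      sortKey f.1 a < sortKey f.1 b := by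
  rw [← (sortPerm_strictMono f).lt_iff_lt]
  simp only [Function.comp_apply, Equiv.apply_symm_apply]

/-- The relations `≤⁺` and `≤⁻` differ only at ties: equal values are allowed for `i < j` when even
and for `i > j` when odd, which is the tie-breaking rule of the key. -/
theorem isEnrichedPartition_permPoset_iff {n k : ℕ} {π : signedPerm n} {f : OddMap n (2 * k)} :
    IsEnrichedPartition (permPoset π) k f.1 ↔ sortPerm f = π := by
  rw [sortPerm_eq_iff]
  constructor
  · intro h i j hij
    have hlt : (permPoset π).lt ((π : Equiv.Perm (PMInt n)) i) ((π : Equiv.Perm (PMInt n)) j) := by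
      simpa only [permPoset, Equiv.symm_apply_apply] using hij
    have hne := (π : Equiv.Perm (PMInt n)).injective.ne hij.ne
    rw [Function.comp_apply, Function.comp_apply, sortKey_lt_iff]
    rcases lt_or_gt_of_ne hne with h' | h'
    · refine (h.lePlus _ _ hlt h').imp_right fun ⟨e, p⟩ => ⟨e, ?_⟩
      rwa [if_pos (show Even _ from p)]
    · refine (h.leMinus _ _ hlt h').imp_right fun ⟨e, p⟩ => ⟨e, ?_⟩
      rwa [if_neg (show ¬ Even _ from p)]
  · intro h
    have key : ∀ a b, (permPoset π).lt a b → sortKey f.1 a < sortKey f.1 b := fun a b hab => by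
      simpa only [Function.comp_apply, Equiv.apply_symm_apply] using h hab
    refine ⟨f.2, fun a b hab hlt => ?_, fun a b hab hlt => ?_⟩
    · refine (sortKey_lt_iff.mp (key a b hab)).imp_right fun ⟨e, p⟩ => ⟨e, ?_⟩
      by_contra hp
      rw [if_neg (show ¬ Even _ from hp)] at p
      exact lt_asymm p hlt
    · refine (sortKey_lt_iff.mp (key a b hab)).imp_right fun ⟨e, p⟩ => ⟨e, fun hp => ?_⟩
      rw [if_pos (show Even _ from hp)] at p
      exact lt_asymm p hlt

theorem enrichedCount_permPoset {n : ℕ} (π : signedPerm n) (k : ℕ) :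
    enrichedCount (permPoset π) k = Nat.card {f : OddMap n (2 * k) // sortPerm f = π} :=
  Nat.card_congr
    { toFun := fun f => ⟨⟨f.1, f.2.map_neg⟩, isEnrichedPartition_permPoset_iff.mp f.2⟩
      invFun := fun f => ⟨f.1.1, isEnrichedPartition_permPoset_iff.mpr f.2⟩
      left_inv := fun _ => rfl
      right_inv := fun _ => rfl }

/-! ### The product formula -/

theorem Int.mul_add_lt_mul_add {c x y x' y' : ℤ} (hc : 0 ≤ c) (hy : y ≤ c) (hy' : -c ≤ y')
    (h : x < x') : (2 * c + 1) * x + y < (2 * c + 1) * x' + y' := by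
  nlinarith [mul_le_mul_of_nonneg_left (Int.add_one_le_iff.mpr h) (show 0 ≤ 2 * c + 1 by omega)]

/-- The order of `±[l]' × ±[k]'` in which pairs are compared by the first entry, then by the
second one, increasingly or decreasingly as the first entry is even or odd, identified with
`±[4kl + k + l]'`. -/
def pairRank (k l : ℕ) (p : PMInt (2 * l) × PMInt (2 * k)) : PMInt (2 * (4 * k * l + k + l)) :=
  -- A two-digit numeral in base `4k + 1` with balanced last digit; the extreme value is `(4k + 1) *
  -- 2l + 2k = 2(4kl + k + l)`.
  ⟨(2 * (2 * k : ℕ) + 1) * p.1.1 + if Even p.1.1 then p.2.1 else -p.2.1, by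
    have h1 := p.1.neg_le
    have h2 := p.1.le
    have h3 := p.2.neg_le
    have h4 := p.2.le
    have h5 := mul_le_mul_of_nonneg_left h1 (show (0 : ℤ) ≤ 2 * (2 * k : ℕ) + 1 by omega)
    have h6 := mul_le_mul_of_nonneg_left h2 (show (0 : ℤ) ≤ 2 * (2 * k : ℕ) + 1 by omega)
    rw [Finset.mem_Icc]
    push_cast at *
    split_ifs <;> constructor <;> linarith⟩

theorem pairRank_lt_iff {k l : ℕ} {x x' : PMInt (2 * l)} {y y' : PMInt (2 * k)} :
    pairRank k l (x, y) < pairRank k l (x', y') ↔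
      x < x' ∨ (x = x' ∧ if Even x.1 then y < y' else y' < y) := by
  have hlt : ∀ {x x' : PMInt (2 * l)} {y y' : PMInt (2 * k)}, x < x' →
      pairRank k l (x, y) < pairRank k l (x', y') := fun {x x' y y'} h => by
    have h1 := y.neg_le
    have h2 := y.le
    have h3 := y'.neg_le
    have h4 := y'.le
    refine Int.mul_add_lt_mul_add (Int.natCast_nonneg _) ?_ ?_ (Subtype.coe_lt_coe.mpr h) <;>
      dsimp only <;> split_ifs <;> omega
  rcases lt_trichotomy x x' with h | rfl | h
  · simp only [hlt h, h, true_or]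
  · rw [← Subtype.coe_lt_coe, pairRank, pairRank]
    by_cases he : Even x.1
    · simp [he]
    · simp only [he, if_false, true_and, lt_self_iff_false, false_or, ← Subtype.coe_lt_coe]
      omega
  · simp only [(hlt h).not_gt, h.not_gt, h.ne', false_and, or_self]

theorem pairRank_injective (k l : ℕ) : Function.Injective (pairRank k l) := by
  rintro ⟨x, y⟩ ⟨x', y'⟩ h
  have h1 := mt pairRank_lt_iff.mpr h.not_lt
  have h2 := mt pairRank_lt_iff.mpr h.not_gt
  rw [not_or, not_lt] at h1 h2
  obtain rfl := le_antisymm h2.1 h1.1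
  have h3 := h1.2
  have h4 := h2.2
  simp only [true_and] at h3 h4
  split_ifs at h3 h4
  · rw [le_antisymm (not_lt.mp h4) (not_lt.mp h3)]
  · rw [le_antisymm (not_lt.mp h3) (not_lt.mp h4)]

theorem pairRank_bijective (k l : ℕ) : Function.Bijective (pairRank k l) := by
  refine (Fintype.bijective_iff_injective_and_card _).mpr ⟨pairRank_injective k l, ?_⟩
  rw [Fintype.card_prod, PMInt.card, PMInt.card, PMInt.card]
  ring

theorem pairRank_neg {k l : ℕ} (x : PMInt (2 * l)) (y : PMInt (2 * k)) :
    pairRank k l (-x, -y) = -pairRank k l (x, y) := by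
  apply Subtype.ext
  simp only [pairRank, PMInt.coe_neg, even_neg]
  split_ifs <;> ring

/-- The base `4k + 1` is odd, so the exponent `ε` is multiplicative on pairs. -/
theorem even_pairRank {k l : ℕ} {x : PMInt (2 * l)} {y : PMInt (2 * k)} :
    Even (pairRank k l (x, y)).1 ↔ (Even x.1 ↔ Even y.1) := by
  rw [pairRank]
  split_ifs with hx <;> simp only [Int.even_add, Int.even_mul, even_neg, hx] <;> simp

theorem signedPerm_symm_neg {n : ℕ} (σ : signedPerm n) (a : PMInt n) :
    (σ : Equiv.Perm (PMInt n)).symm (-a) = -(σ : Equiv.Perm (PMInt n)).symm a :=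
  (signedPerm n).inv_mem σ.2 a

/-- The map to `±[4kl + k + l]'` that combines a map to `±[k]'` with a map to `±[l]'` of the
sorted indices. -/
noncomputable def combine {n k l : ℕ} (f : OddMap n (2 * k)) (g : OddMap n (2 * l)) :
    OddMap n (2 * (4 * k * l + k + l)) :=
  ⟨fun a => pairRank k l (g.1 ((sortPerm f : Equiv.Perm (PMInt n)).symm a), f.1 a), fun a => by
    beta_reduce
    rw [signedPerm_symm_neg, f.2, g.2, pairRank_neg]⟩

/-- Where the `g`-values tie, comparing `f`-values and then indices amounts to comparing the keys of
`f`, reversed if the common `g`-value is odd. The order of those keys is the order of the indices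
after `(sortPerm f)⁻¹`, so this is the tie-breaking rule of `g`. -/
theorem sortKey_combine_lt_iff {n k l : ℕ} (f : OddMap n (2 * k)) (g : OddMap n (2 * l))
    {a b : PMInt n} :
    sortKey (combine f g).1 a < sortKey (combine f g).1 b ↔
      sortKey g.1 ((sortPerm f : Equiv.Perm (PMInt n)).symm a) <
        sortKey g.1 ((sortPerm f : Equiv.Perm (PMInt n)).symm b) := by
  rw [sortKey_lt_iff, sortKey_lt_iff (f := g.1), sortPerm_symm_lt_iff, sortPerm_symm_lt_iff,
    sortKey_lt_iff, sortKey_lt_iff (a := b)]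
  have hab : (combine f g).1 a = (combine f g).1 b ↔
      g.1 ((sortPerm f : Equiv.Perm (PMInt n)).symm a) =
        g.1 ((sortPerm f : Equiv.Perm (PMInt n)).symm b) ∧ f.1 a = f.1 b :=
    (pairRank_injective k l).eq_iff.trans Prod.mk_inj
  rw [hab]
  simp only [combine, pairRank_lt_iff, even_pairRank]
  generalize g.1 ((sortPerm f : Equiv.Perm (PMInt n)).symm a) = x
  generalize g.1 ((sortPerm f : Equiv.Perm (PMInt n)).symm b) = x'
  rw [or_assoc, and_assoc, ← and_or_left]
  refine or_congr_right (and_congr_right fun _ => ?_)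
  by_cases hx : Even x.1
  · simp only [hx, if_true, true_iff]
  · simp only [hx, if_false, false_iff]
    refine or_congr_right ?_
    rw [eq_comm]
    refine and_congr_right fun h => ?_
    simp only [h, ite_not]

theorem sortPerm_combine {n k l : ℕ} (f : OddMap n (2 * k)) (g : OddMap n (2 * l)) :
    sortPerm (combine f g) = sortPerm f * sortPerm g := by
  rw [sortPerm_eq_iff]
  intro i j hij
  rw [Function.comp_apply, Function.comp_apply, sortKey_combine_lt_iff]
  rw [Subgroup.coe_mul, Equiv.Perm.mul_apply, Equiv.Perm.mul_apply, Equiv.symm_apply_apply,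
    Equiv.symm_apply_apply]
  exact sortPerm_strictMono g hij

theorem combine_bijective (n k l : ℕ) :
    Function.Bijective fun p : OddMap n (2 * k) × OddMap n (2 * l) => combine p.1 p.2 := by
  constructor
  · rintro ⟨f, g⟩ ⟨f', g'⟩ h
    have h' : ∀ a, g.1 ((sortPerm f : Equiv.Perm (PMInt n)).symm a) =
        g'.1 ((sortPerm f' : Equiv.Perm (PMInt n)).symm a) ∧ f.1 a = f'.1 a := fun a =>
      Prod.mk_inj.mp (pairRank_injective k l (congrFun (congrArg Subtype.val h) a))
    obtain rfl : f = f' := Subtype.ext (funext fun a => (h' a).2)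
    refine Prod.ext rfl (Subtype.ext (funext fun a => ?_))
    simpa only [Equiv.symm_apply_apply] using
      (h' ((sortPerm f : Equiv.Perm (PMInt n)) a)).1
  · intro h
    choose p hp using fun a => (pairRank_bijective k l).2 (h.1 a)
    have hneg : ∀ a, p (-a) = (-(p a).1, -(p a).2) := fun a =>
      pairRank_injective k l (by rw [hp, h.2, pairRank_neg, hp])
    -- The second entries give `f` directly; once `f` is known, `sortPerm f` undoes the reindexing
    -- of `g`.
    let f : OddMap n (2 * k) := ⟨fun a => (p a).2, fun a => by simp only [hneg]⟩
    let g : OddMap n (2 * l) :=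
      ⟨fun a => (p ((sortPerm f : Equiv.Perm (PMInt n)) a)).1, fun a => by
        beta_reduce
        rw [(sortPerm f).2, hneg]⟩
    refine ⟨(f, g), Subtype.ext (funext fun a => ?_)⟩
    simp only [combine, g, Equiv.apply_symm_apply]
    exact hp a

theorem enrichedCount_permPoset_mul {n : ℕ} (π : signedPerm n) (k l : ℕ) :
    enrichedCount (permPoset π) (4 * k * l + k + l) =
      ∑ p : signedPerm n × signedPerm n with p.1 * p.2 = π,
        enrichedCount (permPoset p.1) k * enrichedCount (permPoset p.2) l := by
  classical
  let e := Equiv.ofBijective _ (combine_bijective n k l)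
  have h1 : enrichedCount (permPoset π) (4 * k * l + k + l) =
      Nat.card {q : OddMap n (2 * k) × OddMap n (2 * l) // sortPerm q.1 * sortPerm q.2 = π} := by
    rw [enrichedCount_permPoset]
    exact Nat.card_congr (e.subtypeEquiv fun q => by
      rw [← sortPerm_combine]
      rfl).symm
  rw [h1, Nat.card_eq_fintype_card, Fintype.card_subtype,
    Finset.card_eq_sum_card_fiberwise (f := fun q => (sortPerm q.1, sortPerm q.2))
      (t := Finset.univ.filter fun p : signedPerm n × signedPerm n => p.1 * p.2 = π)
      (fun q hq => by simpa using hq)]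
  refine Finset.sum_congr rfl fun p hp => ?_
  rw [enrichedCount_permPoset, enrichedCount_permPoset, ← Nat.card_prod,
    Nat.card_eq_fintype_card, Finset.filter_filter, ← Fintype.card_subtype]
  refine Fintype.card_congr ?_
  refine (Equiv.subtypeEquivRight fun q => ?_).trans Equiv.subtypeProdEquivProd
  rw [Prod.ext_iff]
  refine ⟨And.right, fun h => ⟨?_, h⟩⟩
  rw [h.1, h.2]
  exact (Finset.mem_filter.mp hp).2

/-! ### Polynomials from vanishing finite differences -/

/-- Newton's forward difference formula, cut off at order `m`. -/
theorem exists_polynomial_of_fwdDiff_iter_eq_zero {m : ℕ} {f : ℕ → ℚ}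
    (hf : (fwdDiff 1)^[m + 1] f = 0) :
    ∃ p : ℚ[X], p.natDegree ≤ m ∧ ∀ k : ℕ, p.eval (k : ℚ) = f k := by
  have hzero : ∀ i, m + 1 ≤ i → (fwdDiff 1)^[i] f = 0 := fun i hi => by
    obtain ⟨d, rfl⟩ := Nat.exists_eq_add_of_le' hi
    rw [Function.iterate_add_apply, hf]
    exact Function.iterate_fixed (fwdDiff_const 1 (0 : ℚ)) d
  refine ⟨∑ i ∈ Finset.range (m + 1),
    C ((fwdDiff 1)^[i] f 0 / (i.factorial : ℚ)) * descPochhammer ℚ i, ?_, fun k => ?_⟩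
  · refine natDegree_sum_le_of_forall_le _ _ fun i hi => ?_
    refine (natDegree_C_mul_le _ _).trans ?_
    rw [descPochhammer_natDegree]
    exact Nat.lt_succ_iff.mp (Finset.mem_range.mp hi)
  · have h := shift_eq_sum_fwdDiff_iter 1 f k 0
    rw [smul_eq_mul, mul_one, zero_add] at h
    have hterm : ∀ i, eval (k : ℚ) (C ((fwdDiff 1)^[i] f 0 / (i.factorial : ℚ)) *
        descPochhammer ℚ i) = k.choose i • (fwdDiff 1)^[i] f 0 := fun i => by
      rw [eval_C_mul, nsmul_eq_mul, Nat.cast_choose_eq_descPochhammer_div]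
      ring
    rw [h, eval_finsetSum, Finset.sum_congr rfl fun i _ => hterm i]
    -- The polynomial stops at `m` and Newton's expansion at `k`; both sums extend by zero terms to
    -- a common range.
    have hl := Finset.sum_subset (Finset.range_mono (le_max_left (m + 1) (k + 1)))
      (f := fun i => k.choose i • (fwdDiff 1)^[i] f 0) fun i _ hi => by
        rw [hzero i (by simpa using hi), Pi.zero_apply, smul_zero]
    have hr := Finset.sum_subset (Finset.range_mono (le_max_right (m + 1) (k + 1)))
      (f := fun i => k.choose i • (fwdDiff 1)^[i] f 0) fun i _ hi => by
        rw [Nat.choose_eq_zero_of_lt (by simpa using hi), zero_smul]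
    exact hl.trans hr.symm

/-! ### Counting chains of values -/

/-- `r` may be followed by `s` at an ascent (if `asc` holds) or at a descent (if not). -/
def Link (asc : Prop) (r s : ℕ) : Prop := r < s ∨ (r = s ∧ (Even r ↔ asc))

open Classical in
/-- The sequences `0 = g 0, …, g m = r`, continued by `0`, whose neighbours are linked. -/
noncomputable def chains (asc : ℕ → Prop) : ℕ → ℕ → Finset (ℕ → ℕ)
  | 0, r => if r = 0 then {0} else ∅
  | m + 1, r => ((Finset.range (r + 1)).filter (Link (asc m) · r)).biUnion fun s =>
      (chains asc m s).image fun g => Function.update g (m + 1) r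

theorem mem_chains {asc : ℕ → Prop} {m r : ℕ} {g : ℕ → ℕ} :
    g ∈ chains asc m r ↔
      g 0 = 0 ∧ g m = r ∧ (∀ i < m, Link (asc i) (g i) (g (i + 1))) ∧ ∀ i > m, g i = 0 := by
  induction m generalizing r g with
  | zero =>
    rw [chains]
    split_ifs with hr
    · rw [Finset.mem_singleton, hr]
      constructor
      · rintro rfl
        simp
      · rintro ⟨h0, -, -, h⟩
        funext i
        rcases Nat.eq_zero_or_pos i with rfl | hi
        · exact h0
        · exact h i hi
    · simp only [Finset.notMem_empty, false_iff]
      rintro ⟨h0, hr', -⟩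
      exact hr (hr'.symm.trans h0)
  | succ m ih =>
    simp only [chains, Finset.mem_biUnion, Finset.mem_image, Finset.mem_filter, Finset.mem_range]
    constructor
    · rintro ⟨s, ⟨-, hlink⟩, g, hg, rfl⟩
      obtain ⟨h0, hm, hl, hz⟩ := ih.mp hg
      have hne : ∀ i ≤ m, Function.update g (m + 1) r i = g i := fun i hi =>
        Function.update_of_ne (by omega) _ _
      refine ⟨by rw [hne 0 (Nat.zero_le _), h0], Function.update_self .., fun i hi => ?_,
        fun i hi => ?_⟩
      · rw [hne i (by omega)]
        rcases Nat.lt_succ_iff_lt_or_eq.mp hi with hi | rfl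
        · rw [hne (i + 1) hi]
          exact hl i hi
        · rwa [Function.update_self, hm]
      · rw [Function.update_of_ne (by omega)]
        exact hz i (by omega)
    · rintro ⟨h0, hr, hl, hz⟩
      have hne : ∀ i, i ≠ m + 1 → Function.update g (m + 1) 0 i = g i := fun i hi =>
        Function.update_of_ne hi _ _
      have hlink := hl m (Nat.lt_succ_self m)
      rw [hr] at hlink
      refine ⟨g m, ⟨?_, hlink⟩, Function.update g (m + 1) 0, ih.mpr ⟨?_, ?_, ?_, ?_⟩, ?_⟩
      · rcases hlink with h | h <;> omega
      · rw [hne 0 (by omega), h0]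
      · rw [hne m (by omega)]
      · intro i hi
        rw [hne i (by omega), hne (i + 1) (by omega)]
        exact hl i (by omega)
      · intro i hi
        rcases eq_or_ne i (m + 1) with rfl | h
        · rw [Function.update_self]
        · rw [hne i h]
          exact hz i (by omega)
      · rw [Function.update_idem, ← hr, Function.update_eq_self]

-- The entry before the final `r` may be any smaller `s`, or `r` itself if its parity suits the last
-- position. The zero tail makes the shorter chain recoverable from the longer one.
open Classical in
theorem card_chains_succ (asc : ℕ → Prop) (m r : ℕ) :
    (chains asc (m + 1) r).card = ∑ s ∈ Finset.range r, (chains asc m s).card +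
      if Even r ↔ asc m then (chains asc m r).card else 0 := by
  have hinj : ∀ {s s' : ℕ} {g g' : ℕ → ℕ}, g ∈ chains asc m s → g' ∈ chains asc m s' →
      Function.update g (m + 1) r = Function.update g' (m + 1) r → g = g' := by
    intro s s' g g' hg hg' h
    funext i
    rcases eq_or_ne i (m + 1) with rfl | hi
    · rw [(mem_chains.mp hg).2.2.2 _ (Nat.lt_succ_self m),
        (mem_chains.mp hg').2.2.2 _ (Nat.lt_succ_self m)]
    · simpa only [Function.update_of_ne hi] using congrFun h i
  rw [chains, Finset.card_biUnion]
  · have hcard : ∀ s, ((chains asc m s).image fun g => Function.update g (m + 1) r).card =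
        (chains asc m s).card := fun s =>
      Finset.card_image_of_injOn fun g hg g' hg' h => hinj hg hg' h
    simp only [hcard]
    rw [Finset.sum_filter, Finset.sum_range_succ]
    congr 1
    · refine Finset.sum_congr rfl fun s hs => if_pos ?_
      exact Or.inl (Finset.mem_range.mp hs)
    · simp only [Link, lt_self_iff_false, true_and, false_or]
  · intro s _ s' _ hss
    rw [Function.onFun, Finset.disjoint_left]
    intro g hg hg'
    obtain ⟨g₁, h₁, rfl⟩ := Finset.mem_image.mp hg
    obtain ⟨g₂, h₂, h⟩ := Finset.mem_image.mp hg'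
    obtain rfl := hinj h₂ h₁ h
    exact hss ((mem_chains.mp h₁).2.1.symm.trans (mem_chains.mp h₂).2.1)

theorem fwdDiff_iter_succ_eq_zero {m : ℕ} {f : ℕ → ℚ} (hf : (fwdDiff 1)^[m] f = 0) :
    (fwdDiff 1)^[m + 1] f = 0 := by
  rw [Function.iterate_succ_apply', hf]
  exact fwdDiff_const 1 (0 : ℚ)

theorem fwdDiff_iter_ite_eq_zero {m : ℕ} {f : ℕ → ℚ} (hf : (fwdDiff 1)^[m] f = 0) (c : Prop)
    [Decidable c] : (fwdDiff 1)^[m] (fun k => if c then f k else 0) = 0 := by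
  split_ifs
  · exact hf
  · exact Function.iterate_fixed (fwdDiff_const 1 (0 : ℚ)) m

theorem fwdDiff_iter_add_eq_zero {m : ℕ} {f g : ℕ → ℚ} (hf : (fwdDiff 1)^[m] f = 0)
    (hg : (fwdDiff 1)^[m] g = 0) : (fwdDiff 1)^[m] (fun k => f k + g k) = 0 := by
  have h := fwdDiff_iter_add 1 f g m
  rw [hf, hg, add_zero] at h
  exact h

/-- The numbers of chains ending at `2k + 1`, at `2k + 2`, and at most at `2k`, respectively, are
polynomials in `k`. -/
theorem fwdDiff_iter_card_chains (asc : ℕ → Prop) (m : ℕ) :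
    (fwdDiff 1)^[m] (fun k => ((chains asc m (2 * k + 1)).card : ℚ)) = 0 ∧
    (fwdDiff 1)^[m] (fun k => ((chains asc m (2 * k + 2)).card : ℚ)) = 0 ∧
    (fwdDiff 1)^[m + 1]
      (fun k => ((∑ r ∈ Finset.range (2 * k + 1), (chains asc m r).card : ℕ) : ℚ)) = 0 := by
  classical
  -- Passing from `k` to `k + 1` adds the chains ending at `2k + 1` and `2k + 2`, so one difference
  -- of the partial sums leaves these two counts.
  have step : ∀ m, (fwdDiff 1)^[m] (fun k => ((chains asc m (2 * k + 1)).card : ℚ)) = 0 →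
      (fwdDiff 1)^[m] (fun k => ((chains asc m (2 * k + 2)).card : ℚ)) = 0 →
      (fwdDiff 1)^[m + 1]
        (fun k => ((∑ r ∈ Finset.range (2 * k + 1), (chains asc m r).card : ℕ) : ℚ)) = 0 := by
    intro m hA hB
    rw [Function.iterate_succ_apply]
    convert fwdDiff_iter_add_eq_zero hA hB using 2
    funext k
    rw [fwdDiff, show 2 * (k + 1) + 1 = 2 * k + 1 + 1 + 1 by ring, Finset.sum_range_succ,
      Finset.sum_range_succ]
    push_cast
    ring
  suffices h : (fwdDiff 1)^[m] (fun k => ((chains asc m (2 * k + 1)).card : ℚ)) = 0 ∧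
      (fwdDiff 1)^[m] (fun k => ((chains asc m (2 * k + 2)).card : ℚ)) = 0 from
    ⟨h.1, h.2, step m h.1 h.2⟩
  induction m with
  -- A chain of length 0 ends at 0, never at `2k + 1` or `2k + 2`; hence order `m` suffices for
  -- these counts, one less than for the partial sums.
  | zero => constructor <;> funext k <;> simp [chains]
  | succ m ih =>
    have hU := step m ih.1 ih.2
    have hA := fwdDiff_iter_succ_eq_zero ih.1
    have hB := fwdDiff_iter_succ_eq_zero ih.2
    constructor
    · convert fwdDiff_iter_add_eq_zero hU
        (fwdDiff_iter_ite_eq_zero hA (¬ asc m)) using 2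
      funext k
      rw [card_chains_succ]
      have : ¬ Even (2 * k + 1) := by simp
      simp only [this, false_iff]
      push_cast
      rfl
    · convert fwdDiff_iter_add_eq_zero (fwdDiff_iter_add_eq_zero hU hA)
        (fwdDiff_iter_ite_eq_zero hB (asc m)) using 2
      funext k
      rw [card_chains_succ, Finset.sum_range_succ]
      have : Even (2 * k + 2) := ⟨k + 1, by ring⟩
      simp only [this, true_iff]
      push_cast
      rfl

/-! ### Odd maps with a given sorting permutation as chains -/

/-- The element `min i n` of `±[n]`. -/
def PMInt.ofNat (n i : ℕ) : PMInt n :=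
  ⟨(min i n : ℕ), Finset.mem_Icc.mpr ⟨by omega, by omega⟩⟩

theorem PMInt.eq_ofNat {n : ℕ} {a : PMInt n} (ha : 0 ≤ a.1) : a = PMInt.ofNat n a.1.natAbs := by
  have h := a.le
  apply Subtype.ext
  change a.1 = (min a.1.natAbs n : ℕ)
  omega

theorem PMInt.coe_ofNat {n i : ℕ} (hi : i ≤ n) : (PMInt.ofNat n i).1 = i :=
  congrArg Nat.cast (min_eq_left hi)

theorem PMInt.ofNat_zero (n : ℕ) : -PMInt.ofNat n 0 = PMInt.ofNat n 0 := by
  apply Subtype.ext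
  rw [PMInt.coe_neg, PMInt.coe_ofNat (Nat.zero_le n), Nat.cast_zero, neg_zero]

theorem PMInt.eq_ofNat_or_eq_neg {n : ℕ} (a : PMInt n) :
    ∃ i ≤ n, a = PMInt.ofNat n i ∨ a = -PMInt.ofNat n i := by
  have h1 := a.le
  have h2 := a.neg_le
  refine ⟨a.1.natAbs, by omega, ?_⟩
  rcases le_total 0 a.1 with h | h
  · exact Or.inl (PMInt.eq_ofNat h)
  · right
    have h3 : 0 ≤ (-a).1 := Int.neg_nonneg_of_nonpos h
    rw [← PMInt.neg_neg a, PMInt.eq_ofNat h3, PMInt.coe_neg, Int.natAbs_neg, PMInt.coe_neg,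
      PMInt.coe_ofNat (by omega), Int.natAbs_neg, Int.natAbs_natCast]

/-- The hypothesis on negation transfers monotonicity from the nonnegative half to the negative
half; a pair of opposite signs is compared through 0. -/
theorem PMInt.strictMono_iff {n : ℕ} {β : Type*} [Preorder β] {φ : PMInt n → β}
    (hφ : ∀ a b, φ (-a) < φ (-b) ↔ φ b < φ a) :
    StrictMono φ ↔ ∀ i < n, φ (PMInt.ofNat n i) < φ (PMInt.ofNat n (i + 1)) := by
  constructor
  · intro h i hi
    refine h (Subtype.coe_lt_coe.mp ?_)
    rw [PMInt.coe_ofNat hi.le, PMInt.coe_ofNat hi]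
    omega
  · intro h
    have hnat : ∀ i j, i < j → j ≤ n → φ (PMInt.ofNat n i) < φ (PMInt.ofNat n j) := by
      intro i j hij
      induction j, hij using Nat.le_induction with
      | base => exact fun hj => h i hj
      | succ j _ ih => exact fun hj => (ih (by omega)).trans (h j hj)
    have hpos : ∀ a b : PMInt n, 0 ≤ a.1 → a.1 < b.1 → φ a < φ b := by
      intro a b ha hab
      have hb := b.le
      rw [PMInt.eq_ofNat ha, PMInt.eq_ofNat (ha.trans hab.le)]
      exact hnat _ _ (by omega) (by omega)
    intro a b hab
    have hab' : a.1 < b.1 := hab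
    rcases le_or_gt 0 a.1 with ha | ha
    · exact hpos a b ha hab'
    · rcases le_or_gt b.1 0 with hb | hb
      · exact (hφ b a).mp (hpos (-b) (-a) (Int.neg_nonneg_of_nonpos hb)
          (Int.neg_lt_neg hab'))
      · have h0 : (PMInt.ofNat n 0).1 = 0 := PMInt.coe_ofNat (Nat.zero_le n)
        refine lt_trans ((hφ _ _).mp ?_) (hpos (PMInt.ofNat n 0) b h0.ge (h0 ▸ hb))
        rw [PMInt.ofNat_zero]
        exact hpos _ _ h0.ge (by rw [h0, PMInt.coe_neg]; omega)

theorem sortPerm_eq_iff_consecutive {n m : ℕ} {f : OddMap n m} {π : signedPerm n} :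
    sortPerm f = π ↔ ∀ i < n,
      sortKey f.1 ((π : Equiv.Perm (PMInt n)) (PMInt.ofNat n i)) <
        sortKey f.1 ((π : Equiv.Perm (PMInt n)) (PMInt.ofNat n (i + 1))) := by
  rw [sortPerm_eq_iff]
  refine PMInt.strictMono_iff fun a b => ?_
  simp only [Function.comp_apply, π.2 a, π.2 b, sortKey_neg_lt_iff]

/-- The positions of the ascents of a signed permutation. -/
def IsAscent {n : ℕ} (π : signedPerm n) (i : ℕ) : Prop :=
  (π : Equiv.Perm (PMInt n)) (PMInt.ofNat n i) < (π : Equiv.Perm (PMInt n)) (PMInt.ofNat n (i + 1))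

theorem signedPerm_ofNat_ne {n i : ℕ} (π : signedPerm n) (hi : i < n) :
    (π : Equiv.Perm (PMInt n)) (PMInt.ofNat n i) ≠
      (π : Equiv.Perm (PMInt n)) (PMInt.ofNat n (i + 1)) := by
  refine (π : Equiv.Perm (PMInt n)).injective.ne fun h => ?_
  have h' := congrArg Subtype.val h
  rw [PMInt.coe_ofNat hi.le, PMInt.coe_ofNat hi] at h'
  omega

theorem sortKey_lt_iff_link {n m i r s : ℕ} {f : OddMap n m} {π : signedPerm n} (hi : i < n)
    (hr : (f.1 ((π : Equiv.Perm (PMInt n)) (PMInt.ofNat n i))).1 = r)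
    (hs : (f.1 ((π : Equiv.Perm (PMInt n)) (PMInt.ofNat n (i + 1)))).1 = s) :
    sortKey f.1 ((π : Equiv.Perm (PMInt n)) (PMInt.ofNat n i)) <
        sortKey f.1 ((π : Equiv.Perm (PMInt n)) (PMInt.ofNat n (i + 1))) ↔
      Link (IsAscent π i) r s := by
  rw [sortKey_lt_iff, Link, ← Subtype.coe_lt_coe, ← Subtype.coe_inj, hr, hs, Nat.cast_lt,
    Nat.cast_inj]
  refine or_congr_right (and_congr_right fun _ => ?_)
  rw [IsAscent]
  simp only [Int.even_coe_nat]
  by_cases h : Even r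
  · simp only [h, if_true, true_iff]
  · simp only [h, if_false, false_iff, not_lt]
    exact ⟨le_of_lt, fun h => lt_of_le_of_ne h (signedPerm_ofNat_ne π hi).symm⟩

theorem OddMap.apply_zero {n m : ℕ} (f : OddMap n m) {a : PMInt n} (ha : a.1 = 0) :
    (f.1 a).1 = 0 := by
  have h1 : -a = a := Subtype.ext (by rw [PMInt.coe_neg, ha, neg_zero])
  have h2 := congrArg Subtype.val (f.2 a)
  rw [h1, PMInt.coe_neg] at h2
  omega

theorem signedPerm_zero {n : ℕ} (π : signedPerm n) :
    ((π : Equiv.Perm (PMInt n)) (PMInt.ofNat n 0)).1 = 0 :=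
  OddMap.apply_zero (⟨(π : Equiv.Perm (PMInt n)), π.2⟩ : OddMap n n) (PMInt.coe_ofNat (Nat.zero_le n))

theorem nonneg_of_sortPerm_eq {n m : ℕ} {f : OddMap n m} {π : signedPerm n}
    (h : sortPerm f = π) (i : ℕ) :
    0 ≤ (f.1 ((π : Equiv.Perm (PMInt n)) (PMInt.ofNat n i))).1 := by
  have h0 := f.apply_zero (signedPerm_zero π)
  have hmono := (sortPerm_eq_iff.mp h).monotone (show PMInt.ofNat n 0 ≤ PMInt.ofNat n i from
    Subtype.coe_le_coe.mp (by simp [PMInt.ofNat]))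
  rcases hmono.eq_or_lt with he | hlt
  · rw [← sortKey_injective f.1 he, h0]
  · rcases sortKey_lt_iff.mp hlt with h' | h'
    · exact h0 ▸ (Subtype.coe_lt_coe.mpr h').le
    · exact (h'.1 ▸ h0).ge

/-- The sequence of the values of an odd map in the order given by a signed permutation. -/
def valueSeq {n m : ℕ} (π : signedPerm n) (f : OddMap n m) (i : ℕ) : ℕ :=
  if i ≤ n then (f.1 ((π : Equiv.Perm (PMInt n)) (PMInt.ofNat n i))).1.natAbs else 0

theorem coe_valueSeq {n m : ℕ} {π : signedPerm n} {f : OddMap n m} (h : sortPerm f = π)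
    {i : ℕ} (hi : i ≤ n) :
    (f.1 ((π : Equiv.Perm (PMInt n)) (PMInt.ofNat n i))).1 = valueSeq π f i := by
  rw [valueSeq, if_pos hi, Int.natAbs_of_nonneg (nonneg_of_sortPerm_eq h i)]

theorem valueSeq_mem_chains {n m : ℕ} {π : signedPerm n} {f : OddMap n m} (h : sortPerm f = π) :
    valueSeq π f ∈ chains (IsAscent π) n (valueSeq π f n) := by
  refine mem_chains.mpr ⟨?_, rfl, fun i hi => ?_, fun i hi => if_neg (by omega)⟩
  · have h0 := coe_valueSeq h (Nat.zero_le n)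
    rw [f.apply_zero (signedPerm_zero π)] at h0
    exact_mod_cast h0.symm
  · rw [← sortKey_lt_iff_link hi (coe_valueSeq h hi.le) (coe_valueSeq h hi)]
    exact sortPerm_eq_iff_consecutive.mp h i hi

theorem valueSeq_injOn {n m : ℕ} (π : signedPerm n) :
    Set.InjOn (valueSeq (m := m) π) {f | sortPerm f = π} := by
  intro f hf g hg hfg
  refine Subtype.ext (funext fun a => ?_)
  have key : ∀ i ≤ n, f.1 ((π : Equiv.Perm (PMInt n)) (PMInt.ofNat n i)) =
      g.1 ((π : Equiv.Perm (PMInt n)) (PMInt.ofNat n i)) := fun i hi =>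
    Subtype.ext (by rw [coe_valueSeq hf hi, coe_valueSeq hg hi, hfg])
  obtain ⟨b, rfl⟩ := (π : Equiv.Perm (PMInt n)).surjective a
  obtain ⟨i, hi, rfl | rfl⟩ := PMInt.eq_ofNat_or_eq_neg b
  · exact key i hi
  · rw [π.2, f.2, g.2, key i hi]

theorem exists_valueSeq_eq {n m r : ℕ} (π : signedPerm n) (hr : r ≤ m) {g : ℕ → ℕ}
    (hg : g ∈ chains (IsAscent π) n r) : ∃ f : OddMap n m, sortPerm f = π ∧ valueSeq π f = g := by
  obtain ⟨h0, hn, hl, hz⟩ := mem_chains.mp hg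
  -- Induction downwards from the last index: links never decrease, so the final entry bounds all
  -- others.
  have hle : ∀ d i, i + d = n → g i ≤ r := by
    intro d
    induction d with
    | zero =>
      rintro i rfl
      exact hn.le
    | succ d ih =>
      intro i hi
      have h1 := ih (i + 1) (by omega)
      rcases hl i (by omega) with h2 | h2 <;> omega
  have hle' : ∀ i, g i ≤ m := fun i => by
    rcases le_or_gt i n with hi | hi
    · exact (hle (n - i) i (by omega)).trans hr
    · rw [hz i hi]
      exact Nat.zero_le m
  -- The odd extension of the chain, to be transported along `π⁻¹`.
  let u : PMInt n → ℤ := fun b => b.1.sign * g b.1.natAbs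
  have hu : ∀ b, -(m : ℤ) ≤ u b ∧ u b ≤ m := fun b => by
    have h := hle' b.1.natAbs
    rcases lt_trichotomy b.1 0 with hb | hb | hb
    · simp only [u, Int.sign_eq_neg_one_of_neg hb]
      omega
    · simp only [u, hb, Int.sign_zero]
      omega
    · simp only [u, Int.sign_eq_one_of_pos hb]
      omega
  let f : OddMap n m :=
    ⟨fun a => ⟨u ((π : Equiv.Perm (PMInt n)).symm a), Finset.mem_Icc.mpr (hu _)⟩, fun a => by
      have hs : (π : Equiv.Perm (PMInt n)).symm (-a) = -(π : Equiv.Perm (PMInt n)).symm a :=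
        (signedPerm n).inv_mem π.2 a
      apply Subtype.ext
      simp only [hs, u, PMInt.coe_neg, Int.sign_neg, Int.natAbs_neg, neg_mul]⟩
  have hf : ∀ i ≤ n, (f.1 ((π : Equiv.Perm (PMInt n)) (PMInt.ofNat n i))).1 = g i := by
    intro i hi
    simp only [f, u, Equiv.symm_apply_apply, PMInt.coe_ofNat hi, Int.natAbs_natCast]
    rcases Nat.eq_zero_or_pos i with rfl | hpos
    · simp [h0]
    · rw [Int.sign_eq_one_of_pos (by omega), one_mul]
  refine ⟨f, sortPerm_eq_iff_consecutive.mpr fun i hi => ?_, funext fun i => ?_⟩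
  · rw [sortKey_lt_iff_link hi (hf i hi.le) (hf (i + 1) hi)]
    exact hl i hi
  · rw [valueSeq]
    split_ifs with hi
    · rw [hf i hi, Int.natAbs_natCast]
    · exact (hz i (by omega)).symm

theorem enrichedCount_eq_sum_chains {n : ℕ} (π : signedPerm n) (k : ℕ) :
    enrichedCount (permPoset π) k =
      ∑ r ∈ Finset.range (2 * k + 1), (chains (IsAscent π) n r).card := by
  classical
  rw [enrichedCount_permPoset, Nat.card_eq_fintype_card, Fintype.card_subtype,
    ← Finset.card_biUnion]
  · refine Finset.card_bij (fun f _ => valueSeq π f) (fun f hf => ?_) (fun f hf g hg h => ?_)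
      fun g hg => ?_
    · have hf' := (Finset.mem_filter.mp hf).2
      refine Finset.mem_biUnion.mpr ⟨_, Finset.mem_range.mpr ?_, valueSeq_mem_chains hf'⟩
      have h := (f.1 ((π : Equiv.Perm (PMInt n)) (PMInt.ofNat n n))).le
      rw [coe_valueSeq hf' le_rfl] at h
      omega
    · exact valueSeq_injOn π (Finset.mem_filter.mp hf).2 (Finset.mem_filter.mp hg).2 h
    · obtain ⟨r, hr, hg⟩ := Finset.mem_biUnion.mp hg
      obtain ⟨f, hf, h⟩ := exists_valueSeq_eq π (Nat.lt_succ_iff.mp (Finset.mem_range.mp hr)) hg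
      exact ⟨f, Finset.mem_filter.mpr ⟨Finset.mem_univ _, hf⟩, h⟩
  · intro r _ s _ hrs
    rw [Function.onFun, Finset.disjoint_left]
    exact fun g hg hg' => hrs ((mem_chains.mp hg).2.1.symm.trans (mem_chains.mp hg').2.1)

/-- The Newton polynomial of the counts has degree at most `n` and agrees with the interpolant at
its `n + 1` nodes, so the two coincide. -/
theorem enrichedOrderPoly_eval {n : ℕ} (π : signedPerm n) (k : ℕ) :
    (enrichedOrderPoly (permPoset π)).eval (k : ℚ) = (enrichedCount (permPoset π) k : ℚ) := by
  obtain ⟨p, hp, he⟩ := exists_polynomial_of_fwdDiff_iter_eq_zero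
    (fwdDiff_iter_card_chains (IsAscent π) n).2.2
  simp only [← enrichedCount_eq_sum_chains] at he
  have h : p = enrichedOrderPoly (permPoset π) := by
    refine Lagrange.eq_interpolate_of_eval_eq _ (fun i _ j _ h => Nat.cast_injective h) ?_
      fun k _ => he k
    rw [Finset.card_range]
    exact degree_le_natDegree.trans_lt (by exact_mod_cast Nat.lt_succ_of_le hp)
  rw [← h, he]

theorem natDegree_enrichedOrderPoly_le {n : ℕ} (P : TypeBPoset n) :
    (enrichedOrderPoly P).natDegree ≤ n := by
  have h := Lagrange.degree_interpolate_lt (s := Finset.range (n + 1)) (v := fun k : ℕ => (k : ℚ))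
    (fun k : ℕ => (enrichedCount P k : ℚ)) (fun i _ j _ h => Nat.cast_injective h)
  rw [Finset.card_range, degree_lt_iff_coeff_zero] at h
  exact natDegree_le_iff_coeff_eq_zero.mpr fun i hi => h i hi

/-! ### Sign functionals -/

theorem OddMap.restrict_bijective (n m : ℕ) :
    Function.Bijective fun (f : OddMap n m) (i : Fin n) => f.1 (PMInt.ofNat n (i + 1)) := by
  constructor
  · intro f g h
    have key : ∀ i ≤ n, f.1 (PMInt.ofNat n i) = g.1 (PMInt.ofNat n i) := by
      intro i hi
      rcases Nat.eq_zero_or_eq_succ_pred i with rfl | hi'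
      · have h0 := PMInt.coe_ofNat (Nat.zero_le n)
        exact Subtype.ext ((f.apply_zero h0).trans (g.apply_zero h0).symm)
      · rw [hi'] at hi ⊢
        exact congrFun h ⟨i.pred, hi⟩
    refine Subtype.ext (funext fun a => ?_)
    obtain ⟨i, hi, rfl | rfl⟩ := PMInt.eq_ofNat_or_eq_neg a
    · exact key i hi
    · rw [f.2, g.2, key i hi]
  · intro g
    let G : ℕ → ℤ := fun i => if h : i - 1 < n then (g ⟨i - 1, h⟩).1 else 0
    have hG : ∀ i, -(m : ℤ) ≤ G i ∧ G i ≤ m := fun i => by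
      simp only [G]
      split_ifs
      · exact ⟨PMInt.neg_le _, PMInt.le _⟩
      · omega
    let u : PMInt n → ℤ := fun a => a.1.sign * G a.1.natAbs
    have hu : ∀ a, -(m : ℤ) ≤ u a ∧ u a ≤ m := fun a => by
      have h := hG a.1.natAbs
      rcases lt_trichotomy a.1 0 with ha | ha | ha
      · simp only [u, Int.sign_eq_neg_one_of_neg ha]
        omega
      · simp only [u, ha, Int.sign_zero]
        omega
      · simp only [u, Int.sign_eq_one_of_pos ha]
        omega
    refine ⟨⟨fun a => ⟨u a, Finset.mem_Icc.mpr (hu a)⟩, fun a => Subtype.ext ?_⟩,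
      funext fun i => Subtype.ext ?_⟩
    · simp only [u, PMInt.coe_neg, Int.sign_neg, Int.natAbs_neg, neg_mul]
    · have hi : (PMInt.ofNat n (i + 1)).1 = (i + 1 : ℕ) := PMInt.coe_ofNat i.2
      simp only [u, G, hi, Int.natAbs_natCast, Nat.add_sub_cancel, i.2, dif_pos, Fin.eta]
      rw [Int.sign_eq_one_of_pos (by omega), one_mul]

/-- The terms of `y` and `-y` cancel unless `y = 0`, which counts as positive. -/
theorem sum_sign_PMInt (m : ℕ) : ∑ y : PMInt m, (if y.1 < 0 then -1 else 1 : ℚ) = 1 := by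
  let ν : Equiv.Perm (PMInt m) := ⟨fun i => -i, fun i => -i, PMInt.neg_neg, PMInt.neg_neg⟩
  have h1 : ∑ y : PMInt m, (if (-y).1 < 0 then -1 else 1 : ℚ) =
      ∑ y : PMInt m, (if y.1 < 0 then -1 else 1 : ℚ) :=
    Equiv.sum_comp ν fun y : PMInt m => (if y.1 < 0 then -1 else 1 : ℚ)
  have h2 : ∑ y : PMInt m, ((if y.1 < 0 then -1 else 1 : ℚ) + if (-y).1 < 0 then -1 else 1) =
      2 := by
    rw [Finset.sum_eq_single (PMInt.ofNat m 0)]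
    · simp only [PMInt.ofNat_zero, PMInt.coe_ofNat (Nat.zero_le m)]
      norm_num
    · intro y _ hy
      have hy0 : y.1 ≠ 0 := fun h => hy (Subtype.ext (h.trans (PMInt.coe_ofNat (Nat.zero_le m)).symm))
      rw [PMInt.coe_neg]
      rcases lt_or_gt_of_ne hy0 with h | h
      · rw [if_pos h, if_neg (by omega)]
        norm_num
      · rw [if_neg (by omega), if_pos (by omega)]
        norm_num
    · exact fun h => absurd (Finset.mem_univ _) h
  rw [Finset.sum_add_distrib, h1] at h2
  linarith

/-- The sign `(-1)^s`, where `s` is the number of the `1 ≤ a ≤ j` with `π⁻¹(a) < 0`. -/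
def partialSign {n : ℕ} (j : ℕ) (π : signedPerm n) : ℚ :=
  ∏ i : Fin n, if i.1 < j ∧
    ((π : Equiv.Perm (PMInt n)).symm (PMInt.ofNat n (i + 1))).1 < 0 then -1 else 1

/-- Compare `a` with 0 in the sorted order: the value 0 is even, so on a tie the positive `a` comes
after 0. -/
theorem sortPerm_symm_neg_iff {n m : ℕ} (f : OddMap n m) {a : PMInt n} (ha : 0 < a.1) :
    ((sortPerm f : Equiv.Perm (PMInt n)).symm a).1 < 0 ↔ (f.1 a).1 < 0 := by
  have h0 : (PMInt.ofNat n 0).1 = 0 := PMInt.coe_ofNat (Nat.zero_le n)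
  have hs : ((sortPerm f : Equiv.Perm (PMInt n)).symm (PMInt.ofNat n 0)).1 = 0 :=
    OddMap.apply_zero
      (⟨(sortPerm f : Equiv.Perm (PMInt n)).symm, signedPerm_symm_neg _⟩ : OddMap n n) h0
  have hf := f.apply_zero h0
  have h := sortPerm_symm_lt_iff f (a := a) (b := PMInt.ofNat n 0)
  rw [← Subtype.coe_lt_coe, hs, sortKey_lt_iff, ← Subtype.coe_lt_coe, ← Subtype.coe_inj, hf] at h
  rw [h]
  refine or_iff_left fun ⟨h1, h2⟩ => ?_
  rw [if_pos (by rw [h1]; exact Even.zero), ← Subtype.coe_lt_coe, h0] at h2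
  omega

/-- The signs can be read off from `f`, whose values at `1, …, n` are free, so the sum factors: each
signed position contributes 1, each of the others `2m + 1`. -/
theorem sum_partialSign {n m j : ℕ} (hj : j ≤ n) :
    ∑ f : OddMap n m, partialSign j (sortPerm f) = (2 * m + 1 : ℚ) ^ (n - j) := by
  classical
  let s : Fin n → PMInt m → ℚ := fun i y => if i.1 < j ∧ y.1 < 0 then -1 else 1
  have h1 : ∑ f : OddMap n m, partialSign j (sortPerm f) =
      ∑ g : Fin n → PMInt m, ∏ i, s i (g i) := by
    refine Fintype.sum_equiv (Equiv.ofBijective _ (OddMap.restrict_bijective n m)) _ _ fun f => ?_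
    refine Finset.prod_congr rfl fun i _ => ?_
    have hi : 0 < (PMInt.ofNat n (i + 1)).1 := by
      rw [PMInt.coe_ofNat i.2]
      omega
    simp only [sortPerm_symm_neg_iff f hi, s, Equiv.ofBijective_apply]
  have h2 : ∀ i : Fin n, ∑ y, s i y = if i.1 < j then 1 else (2 * m + 1 : ℚ) := by
    intro i
    by_cases hi : i.1 < j
    · simp only [s, hi, true_and, if_true, sum_sign_PMInt]
    · simp only [s, hi, false_and, if_false, Finset.sum_const, Finset.card_univ, PMInt.card]
      simp
  have h3 := Finset.prod_univ_sum (fun _ : Fin n => (Finset.univ : Finset (PMInt m))) s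
  rw [Fintype.piFinset_univ] at h3
  rw [h1, ← h3, Finset.prod_congr rfl fun i _ => h2 i, Fin.prod_univ_eq_prod_range
    (fun i => if i < j then 1 else (2 * m + 1 : ℚ)) n, ← Nat.add_sub_of_le hj,
    Finset.prod_range_add, Finset.prod_congr rfl fun i hi => if_pos (Finset.mem_range.mp hi),
    Finset.prod_const_one, one_mul, Finset.prod_congr rfl fun i _ =>
    if_neg (show ¬ j + i < j by omega), Finset.prod_const, Finset.card_range,
    Nat.add_sub_cancel_left]

theorem sum_enrichedCount_mul_partialSign {n j : ℕ} (hj : j ≤ n) (k : ℕ) :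
    ∑ π : signedPerm n, (enrichedCount (permPoset π) k : ℚ) * partialSign j π =
      (4 * k + 1 : ℚ) ^ (n - j) := by
  classical
  have h := sum_partialSign (m := 2 * k) hj
  rw [← Finset.sum_fiberwise_of_maps_to (s := Finset.univ) (t := Finset.univ)
    (g := fun f : OddMap n (2 * k) => sortPerm f) fun _ _ => Finset.mem_univ _] at h
  rw [show (4 * k + 1 : ℚ) = 2 * (2 * k : ℕ) + 1 by push_cast; ring, ← h]
  refine Finset.sum_congr rfl fun π _ => ?_
  rw [Finset.sum_congr rfl fun f hf => by rw [(Finset.mem_filter.mp hf).2], Finset.sum_const,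
    nsmul_eq_mul, enrichedCount_permPoset, Nat.card_eq_fintype_card, Fintype.card_subtype]

/-! ### Coefficients of `ρ_B`: orthogonality and nonvanishing -/

/-- Linear functionals reduce this to rational polynomials that agree at the infinitely many points
`4k + 1`. -/
theorem eq_of_sum_pow_smul_eq {M : Type*} [AddCommGroup M] [Module ℚ M] {N : ℕ} {c d : ℕ → M}
    (h : ∀ k : ℕ, ∑ i ∈ Finset.range N, (4 * k + 1 : ℚ) ^ i • c i =
      ∑ i ∈ Finset.range N, (4 * k + 1 : ℚ) ^ i • d i) {i : ℕ} (hi : i < N) : c i = d i := by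
  rw [← sub_eq_zero, ← Module.forall_dual_apply_eq_zero_iff ℚ]
  intro φ
  let p : ℕ → ℚ[X] := fun n => ∑ i ∈ Finset.range N, C (φ (if n = 0 then c i else d i)) * X ^ i
  have hp : p 0 = p 1 := by
    refine eq_of_infinite_eval_eq _ _ (Set.infinite_of_injective_forall_mem
      (f := fun k : ℕ => (4 * k + 1 : ℚ)) (fun a b hab => by simpa using hab) fun k => ?_)
    have h' := congrArg φ (h k)
    simp only [map_sum, map_smul, smul_eq_mul] at h'
    simp only [p, Set.mem_ofPred_eq, eval_finsetSum, eval_mul, eval_C, eval_pow, eval_X, if_true,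
      one_ne_zero, if_false]
    simpa only [mul_comm] using h'
  have hc := congrArg (fun q => q.coeff i) hp
  simp only [p, finsetSum_coeff, coeff_C_mul_X_pow, Finset.sum_ite_eq, Finset.mem_range, hi,
    if_true, one_ne_zero, if_false] at hc
  rw [map_sub, hc, sub_self]

theorem rhoB_summand_natDegree_le {n : ℕ} (π : signedPerm n) :
    ((enrichedOrderPoly (permPoset π)).comp (C (1 / 4 : ℚ) * (X - 1))).natDegree ≤ n := by
  have h1 : (C (1 / 4 : ℚ) * (X - 1)).natDegree ≤ 1 := by
    refine (natDegree_C_mul_le _ _).trans ?_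
    rw [← C_1, natDegree_X_sub_C]
  calc _ ≤ _ := natDegree_comp_le
    _ ≤ n * 1 := Nat.mul_le_mul (natDegree_enrichedOrderPoly_le _) h1
    _ = n := mul_one n

theorem ePrime_eq (n i : ℕ) :
    ePrime n i = ∑ π : signedPerm n,
      ((enrichedOrderPoly (permPoset π)).comp (C (1 / 4 : ℚ) * (X - 1))).coeff i •
        MonoidAlgebra.of ℚ (signedPerm n) π := by
  rw [ePrime, rhoB, finsetSum_coeff]
  refine Finset.sum_congr rfl fun π _ => ?_
  rw [coeff_mul_C, coeff_map, Algebra.smul_def]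

theorem rhoB_eq_sum (n : ℕ) :
    rhoB n = ∑ i ∈ Finset.range (n + 1), C (ePrime n i) * X ^ i := by
  refine as_sum_range_C_mul_X_pow' _ (Nat.lt_succ_of_le ?_)
  refine natDegree_sum_le_of_forall_le _ _ fun π _ => ?_
  exact (natDegree_mul_C_le _ _).trans (natDegree_map_le.trans (rhoB_summand_natDegree_le π))

theorem sum_pow_smul_ePrime (n k : ℕ) :
    ∑ i ∈ Finset.range (n + 1), (4 * k + 1 : ℚ) ^ i • ePrime n i =
      ∑ π : signedPerm n,
        (enrichedCount (permPoset π) k : ℚ) • MonoidAlgebra.of ℚ (signedPerm n) π := by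
  simp only [ePrime_eq, Finset.smul_sum, smul_smul]
  rw [Finset.sum_comm]
  refine Finset.sum_congr rfl fun π _ => ?_
  rw [← Finset.sum_smul]
  congr 1
  have h := eval_eq_sum_range' (Nat.lt_succ_of_le (rhoB_summand_natDegree_le π)) (4 * k + 1 : ℚ)
  rw [eval_comp, eval_mul, eval_C, eval_sub, eval_X, eval_one,
    show 1 / 4 * (4 * (k : ℚ) + 1 - 1) = k by ring, enrichedOrderPoly_eval] at h
  rw [h]
  exact Finset.sum_congr rfl fun i _ => mul_comm _ _

theorem sum_enrichedCount_mul (n k l : ℕ) :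
    (∑ π : signedPerm n,
        (enrichedCount (permPoset π) k : ℚ) • MonoidAlgebra.of ℚ (signedPerm n) π) *
      (∑ π : signedPerm n,
        (enrichedCount (permPoset π) l : ℚ) • MonoidAlgebra.of ℚ (signedPerm n) π) =
      ∑ π : signedPerm n, (enrichedCount (permPoset π) (4 * k * l + k + l) : ℚ) •
        MonoidAlgebra.of ℚ (signedPerm n) π := by
  classical
  rw [Finset.sum_mul_sum, ← Finset.sum_product', Finset.univ_product_univ,
    ← Finset.sum_fiberwise_of_maps_to (s := Finset.univ) (t := Finset.univ)
      (g := fun p : signedPerm n × signedPerm n => p.1 * p.2) fun _ _ => Finset.mem_univ _]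
  refine Finset.sum_congr rfl fun π _ => ?_
  rw [enrichedCount_permPoset_mul, Nat.cast_sum, Finset.sum_smul]
  refine Finset.sum_congr (by congr) fun p hp => ?_
  rw [smul_mul_smul_comm, ← map_mul, (Finset.mem_filter.mp hp).2, Nat.cast_mul]

theorem ePrime_mul {n i j : ℕ} (hi : i ≤ n) (hj : j ≤ n) :
    ePrime n i * ePrime n j = if i = j then ePrime n i else 0 := by
  -- With `y = 4l + 1` fixed, comparing powers of `x` in `ρ_B(x) ρ_B(y) = ρ_B(xy)` gives `e'_i
  -- ρ_B(y) = y^i e'_i`; powers of `y` are compared afterwards.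
  have h1 : ∀ l : ℕ, ∀ i < n + 1,
      ePrime n i * ∑ j ∈ Finset.range (n + 1), (4 * l + 1 : ℚ) ^ j • ePrime n j =
        (4 * l + 1 : ℚ) ^ i • ePrime n i := by
    intro l i hi
    refine eq_of_sum_pow_smul_eq
      (c := fun i => ePrime n i * ∑ j ∈ Finset.range (n + 1), (4 * l + 1 : ℚ) ^ j • ePrime n j)
      (d := fun i => (4 * l + 1 : ℚ) ^ i • ePrime n i) (fun k => ?_) hi
    simp only [← smul_mul_assoc, ← Finset.sum_mul, smul_smul, ← mul_pow]
    rw [sum_pow_smul_ePrime, sum_pow_smul_ePrime, sum_enrichedCount_mul, ← sum_pow_smul_ePrime]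
    refine Finset.sum_congr rfl fun i _ => ?_
    congr 2
    push_cast
    ring
  refine eq_of_sum_pow_smul_eq (c := fun j => ePrime n i * ePrime n j)
    (d := fun j => if i = j then ePrime n i else 0) (fun l => ?_) (Nat.lt_succ_of_le hj)
  have h2 := h1 l i (Nat.lt_succ_of_le hi)
  rw [Finset.mul_sum] at h2
  simp only [mul_smul_comm] at h2
  rw [h2]
  simp only [smul_ite, smul_zero, Finset.sum_ite_eq, Finset.mem_range, Nat.lt_succ_of_le hi,
    if_true]

theorem ePrime_ne_zero {n i : ℕ} (hi : i ≤ n) : ePrime n i ≠ 0 := by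
  -- With `n - i` signed positions, `i` free ones remain, so `φ` sends `ρ_B(4k + 1)` to `(4k + 1)^i`
  -- and picks out `e'_i`.
  let φ : HypAlg n →ₗ[ℚ] ℚ := Finsupp.linearCombination ℚ (partialSign (n - i)) ∘ₗ
    (MonoidAlgebra.coeffLinearEquiv ℚ).toLinearMap
  have hφ : ∀ π, φ (MonoidAlgebra.of ℚ (signedPerm n) π) = partialSign (n - i) π := fun π => by
    simp [φ]
  have h : φ (ePrime n i) = 1 := by
    have := eq_of_sum_pow_smul_eq (N := n + 1) (c := fun j => φ (ePrime n j))
      (d := fun j => if j = i then 1 else 0) (fun k => ?_) (Nat.lt_succ_of_le hi)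
    · simpa only [if_true] using this
    · simp only [← map_smul, ← map_sum, sum_pow_smul_ePrime]
      simp only [map_sum, map_smul, hφ, smul_eq_mul, mul_ite, mul_one, mul_zero,
        Finset.sum_ite_eq', Finset.mem_range, Nat.lt_succ_of_le hi, if_true]
      rw [sum_enrichedCount_mul_partialSign (Nat.sub_le n i), Nat.sub_sub_self hi]
  intro h0
  rw [h0, map_zero] at h
  exact zero_ne_one h

theorem subst₂_rhoB (n : ℕ) (t : (HypAlg n)[X][X]) :
    subst₂ (rhoB n) t = ∑ i ∈ Finset.range (n + 1), C (C (ePrime n i)) * t ^ i := by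
  rw [subst₂, rhoB_eq_sum, eval₂_finsetSum]
  refine Finset.sum_congr rfl fun i _ => ?_
  rw [C_mul_X_pow_eq_monomial, eval₂_monomial, RingHom.comp_apply]

theorem rhoB_mul (n : ℕ) :
    subst₂ (rhoB n) (C X) * subst₂ (rhoB n) X = subst₂ (rhoB n) (C X * X) := by
  rw [subst₂_rhoB, subst₂_rhoB, subst₂_rhoB, Finset.sum_mul_sum]
  refine Finset.sum_congr rfl fun i hi => ?_
  have hcomm : ∀ (a : HypAlg n), (C X : (HypAlg n)[X][X]) ^ i * C (C a) = C (C a) * C X ^ i :=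
    fun a => by rw [← C_pow, ← C_mul, ← C_mul, X_pow_mul_C]
  have hterm : ∀ j ∈ Finset.range (n + 1),
      C (C (ePrime n i)) * C X ^ i * (C (C (ePrime n j)) * X ^ j) =
        if i = j then C (C (ePrime n i)) * (C X * X : (HypAlg n)[X][X]) ^ i else 0 := by
    intro j hj
    rw [mul_assoc, ← mul_assoc (C X ^ i), hcomm, ← mul_assoc, ← mul_assoc, ← C_mul, ← C_mul,
      ePrime_mul (Nat.lt_succ_iff.mp (Finset.mem_range.mp hi))
        (Nat.lt_succ_iff.mp (Finset.mem_range.mp hj))]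
    split_ifs with h
    · rw [← h, (commute_X (C X : (HypAlg n)[X][X])).symm.mul_pow, mul_assoc]
    · rw [C_0, C_0, zero_mul, zero_mul]
  rw [Finset.sum_congr rfl hterm, Finset.sum_ite_eq, if_pos hi]

theorem mainTheorem8 (n : ℕ) :
    (∀ (π : signedPerm n) (k : ℕ),
      (enrichedOrderPoly (permPoset π)).eval (k : ℚ) = (enrichedCount (permPoset π) k : ℚ)) ∧
    (∀ (π : signedPerm n) (k l : ℕ),
      enrichedCount (permPoset π) (4 * k * l + k + l) =
        ∑ p : signedPerm n × signedPerm n with p.1 * p.2 = π,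
          enrichedCount (permPoset p.1) k * enrichedCount (permPoset p.2) l) ∧
    (subst₂ (rhoB n) (C X) * subst₂ (rhoB n) X = subst₂ (rhoB n) (C X * X)) ∧
    (rhoB n = ∑ i ∈ Finset.range (n + 1), C (ePrime n i) * X ^ i) ∧
    (∀ i ≤ n, ePrime n i ≠ 0) ∧
    (∀ i ≤ n, ∀ j ≤ n, ePrime n i * ePrime n j = if i = j then ePrime n i else 0) :=
  ⟨enrichedOrderPoly_eval, enrichedCount_permPoset_mul, rhoB_mul n, rhoB_eq_sum n,
    fun _ hi => ePrime_ne_zero hi, fun _ hi _ hj => ePrime_mul hi hj⟩
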